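/- For an integer $n\ge 1$ let $\|n\|$ denote the integer complexity of $n$, i.e. the least number of $1$'s needed to write $n$ as an expression built from $1$'s using addition, multiplication and parentheses. Let $\delta(n)=\|n\|-3\log_3 n$ be the defect of $n$, and let $\mathscr{D}=\{\delta(n): n\in\mathbb{Z},\ n\ge 1\}\subseteq\mathbb{R}$. Then, with respect to the usual order of $\mathbb{R}$: 1. $\mathscr{D}$ is well-ordered, of order type $\omega^\omega$. 2. For every integer $k\ge 1$, the set $\mathscr{D}\cap[0,k)$ is well-ordered, of order type $\omega^k$. 3. For every integer $k\ge 0$ with $k\ne 1$, the set $\mathscr{D}\cap[0,k]$ is well-ordered, of order type $\omega^k$, while $\mathscr{D}\cap[0,1]$ is well-ordered, of order type $\omega+1$. Here the powers and the sum of ordinals are ordinal powers and the ordinal sum. -/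

import Mathlib

/-- Expressions built from the constant `1` with binary addition and multiplication;
the tree structure is the bracketing. -/
inductive OnesExpr : Type where
  | one : OnesExpr
  | add : OnesExpr → OnesExpr → OnesExpr
  | mul : OnesExpr → OnesExpr → OnesExpr

/-- The value of an expression. -/
def OnesExpr.eval : OnesExpr → ℕ
  | .one => 1
  | .add a b => a.eval + b.eval
  | .mul a b => a.eval * b.eval

/-- The number of ones that an expression uses. -/
def OnesExpr.ones : OnesExpr → ℕ
  | .one => 1
  | .add a b => a.ones + b.ones
  | .mul a b => a.ones + b.ones

/-- Every positive integer is the value of some expression, so that for `n ≥ 1` the set whose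
infimum defines the complexity is nonempty and the infimum is a minimum. -/
theorem OnesExpr.exists_eval_eq (n : ℕ) (hn : 1 ≤ n) : ∃ e : OnesExpr, e.eval = n := by
  induction n, hn using Nat.le_induction with
  | base => exact ⟨.one, rfl⟩
  | succ m _ ih =>
    obtain ⟨e, he⟩ := ih
    exact ⟨.add e .one, by simp [OnesExpr.eval, he]⟩

/-- The integer complexity `‖n‖` of a positive integer `n`: the least number of ones in an
expression with value `n`. -/
noncomputable def integerComplexity (n : ℕ) : ℕ :=
  sInf {k : ℕ | ∃ e : OnesExpr, e.eval = n ∧ e.ones = k}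

/-- The defect `‖n‖ - 3 log₃ n`. -/
noncomputable def defect (n : ℕ) : ℝ :=
  (integerComplexity n : ℝ) - 3 * Real.logb 3 (n : ℝ)

/-- The set of all defects of positive integers. -/
def defectSet : Set ℝ :=
  {x : ℝ | ∃ n : ℕ, 1 ≤ n ∧ defect n = x}

/-- The set `S` of reals is well-ordered by the usual order, and its order type is `o`. -/
def IsWellOrderedOfType (S : Set ℝ) (o : Ordinal.{0}) : Prop :=
  ∃ _ : IsWellOrder S (fun x y : S => x < y), Ordinal.type (fun x y : S => x < y) = o

/-!
Assign to *every* expression `e`, optimal or not, the defect `ones e - 3 log₃ (eval e)`. The set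
`E` of these numbers contains `defectSet`, consists of nonnegative reals, and is closed under
addition, since multiplying expressions adds their defects. Let `F` be its closure.

**Upper bound.** The limit points of `F` are all limits from below and lie in `1 + F`
(`not_strictAnti_closedDefects`, `sub_one_mem_of_strictMono`). For a sum `a + b` with `b ≤ a` the
defect is `defect a + ones b - 3 log₃ (1 + b / a)`. A bound on it bounds `ones b`, so along a
sequence of such sums one may take `b` constant; then either `a` is bounded, and there are only
finitely many defects, or `a → ∞` and the limit is `lim (defect a) + ones b`, where `ones b ≥ 1`.
For products the limits of the two factors add up. This gives an induction on the size of the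
defect (`GoodBelow.step`), in steps of the gap that separates `0` from the other elements of `E`
(`OnesExpr.exists_defect_gap`). Taking limit points `k` times therefore leaves nothing of `F`
below `k`, and a Cantor–Bendixson type count (`exists_rank`) bounds the order type of the part of
`F` below `k` by `ω ^ k`.

**Lower bound.** Applying `k` times an operation `e ↦ e * 3 ^ d + 1`, starting with `3`, yields
defects below `k`, ordered lexicographically by the exponents, hence of order type `ω ^ k`
(`omegaPowLarge_range_defect`). Each of them differs from the defect of an integer by one of
`0, …, k - 1`, and `ω ^ k` is indecomposable, so one of these differences occurs on a subset of
type `ω ^ k` (`omegaPowLarge_defectSet`).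

The closed intervals differ from the half-open ones only in the integral defects, which are `0`,
the defect of `3 ^ i` with `i ≥ 1`, and `1`, the defect of `1` (`natCast_notMem_defectSet`).
-/

open Filter Topology

/-! ### Defects of expressions -/

theorem cube_add_le {a b s t : ℕ} (ha : 1 ≤ a) (hb : 1 ≤ b) (hs : 1 ≤ s) (ht : 1 ≤ t)
    (hba : b ≤ a) (h₁ : a ^ 3 ≤ 3 ^ s) (h₂ : b ^ 3 ≤ 3 ^ t) : (a + b) ^ 3 ≤ 3 ^ (s + t) := by
  have key : (a * b) ^ 3 ≤ 3 ^ (s + t) := by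
    rw [mul_pow, pow_add]; exact Nat.mul_le_mul h₁ h₂
  rcases Nat.lt_or_ge b 2 with hb2 | hb2
  · obtain rfl : b = 1 := by omega
    rcases Nat.lt_or_ge a 3 with ha3 | ha3
    · interval_cases a
      · calc (1 + 1) ^ 3 ≤ 3 ^ 2 := by norm_num
          _ ≤ 3 ^ (s + t) := Nat.pow_le_pow_right (by norm_num) (by omega)
      · have : 2 ≤ s := by
          by_contra h
          obtain rfl : s = 1 := by omega
          norm_num at h₁
        calc (2 + 1) ^ 3 ≤ 3 ^ 3 := by norm_num
          _ ≤ 3 ^ (s + t) := Nat.pow_le_pow_right (by norm_num) (by omega)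
    · calc (a + 1) ^ 3 ≤ a ^ 3 * 3 := by nlinarith [Nat.mul_le_mul ha3 ha3, Nat.mul_le_mul_left (a * a) ha3]
        _ ≤ 3 ^ s * 3 ^ t := Nat.mul_le_mul h₁ (Nat.le_self_pow (by omega) 3)
        _ = 3 ^ (s + t) := (pow_add _ _ _).symm
  · refine le_trans (Nat.pow_le_pow_left ?_ 3) key
    nlinarith

namespace OnesExpr

/-- The defect of an expression: the number of ones minus three times the base-3 logarithm of
the value. The expression need not be optimal for its value. -/
noncomputable def defect (e : OnesExpr) : ℝ := (e.ones : ℝ) - 3 * Real.logb 3 (e.eval : ℝ)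

theorem eval_pos (e : OnesExpr) : 1 ≤ e.eval := by
  induction e with
  | one => exact le_rfl
  | add a b iha ihb => simp only [eval]; omega
  | mul a b iha ihb => exact Nat.mul_pos iha ihb

theorem ones_pos (e : OnesExpr) : 1 ≤ e.ones := by
  induction e with
  | one => exact le_rfl
  | add a b iha ihb => simp only [ones]; omega
  | mul a b iha ihb => simp only [ones]; omega

/-- The classical bound: an expression with `s` ones has value at most `3 ^ (s / 3)`. -/
theorem eval_cube_le (e : OnesExpr) : e.eval ^ 3 ≤ 3 ^ e.ones := by
  induction e with
  | one => norm_num [eval, ones]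
  | add a b iha ihb =>
    simp only [eval, ones]
    rcases le_total b.eval a.eval with h | h
    · exact cube_add_le a.eval_pos b.eval_pos a.ones_pos b.ones_pos h iha ihb
    · rw [add_comm a.eval, add_comm a.ones]
      exact cube_add_le b.eval_pos a.eval_pos b.ones_pos a.ones_pos h ihb iha
  | mul a b iha ihb =>
    simp only [eval, ones, mul_pow, pow_add]; exact Nat.mul_le_mul iha ihb

theorem eval_le (e : OnesExpr) : e.eval ≤ 3 ^ e.ones :=
  le_trans (Nat.le_self_pow (by norm_num) _) e.eval_cube_le

theorem eval_pos_real (e : OnesExpr) : (0 : ℝ) < e.eval := by exact_mod_cast e.eval_pos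

theorem defect_nonneg (e : OnesExpr) : 0 ≤ e.defect := by
  have h : ((e.eval : ℝ)) ^ 3 ≤ 3 ^ (e.ones : ℝ) := by
    rw [Real.rpow_natCast]; exact_mod_cast e.eval_cube_le
  have := (Real.logb_le_iff_le_rpow (b := 3) (by norm_num) (pow_pos e.eval_pos_real 3)).2 h
  rw [Real.logb_pow] at this
  unfold defect
  push_cast at this
  linarith

theorem defect_one : OnesExpr.one.defect = 1 := by simp [defect, eval, ones]

theorem defect_mul (a b : OnesExpr) : (OnesExpr.mul a b).defect = a.defect + b.defect := by
  simp only [defect, eval, ones, Nat.cast_mul, Nat.cast_add]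
  rw [Real.logb_mul a.eval_pos_real.ne' b.eval_pos_real.ne']
  ring

theorem defect_add_comm (a b : OnesExpr) : (OnesExpr.add a b).defect = (OnesExpr.add b a).defect := by
  simp only [defect, eval, ones, add_comm]

theorem defect_add (a b : OnesExpr) : (OnesExpr.add a b).defect =
    a.defect + b.ones - 3 * Real.logb 3 (1 + b.eval / a.eval) := by
  have ha := a.eval_pos_real
  have hb := b.eval_pos_real
  have : ((a.eval : ℝ) + b.eval) = a.eval * (1 + b.eval / a.eval) := by field_simp
  simp only [defect, eval, ones, Nat.cast_add]
  rw [this, Real.logb_mul ha.ne' (by positivity)]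
  ring

theorem logb_three_two_le : 3 * Real.logb 3 2 ≤ 2 := by
  have := (Real.logb_le_iff_le_rpow (b := 3) (x := 2 ^ 3) (y := 2) (by norm_num) (by norm_num)).2
    (by norm_num)
  rw [Real.logb_pow] at this
  exact_mod_cast this

theorem ones_le_defect_add {a b : OnesExpr} (h : b.eval ≤ a.eval) :
    (b.ones : ℝ) ≤ (OnesExpr.add a b).defect + 2 := by
  have ha := a.eval_pos_real
  have hb := b.eval_pos_real
  have h1 : Real.logb 3 (1 + b.eval / a.eval) ≤ Real.logb 3 2 := by
    apply Real.logb_le_logb_of_le (by norm_num) (by positivity)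
    have : (b.eval : ℝ) / a.eval ≤ 1 := by rw [div_le_one ha]; exact_mod_cast h
    linarith
  rw [defect_add]
  linarith [a.defect_nonneg, logb_three_two_le]

/-- Adding a comparatively small summand costs at least half a unit of defect. -/
theorem defect_add_half_le {a b : OnesExpr} (h : 8 * b.eval ≤ a.eval) :
    a.defect + 1 / 2 ≤ (OnesExpr.add a b).defect := by
  have ha := a.eval_pos_real
  have hb := b.eval_pos_real
  have h1 : Real.logb 3 (1 + b.eval / a.eval) ≤ Real.logb 3 (9 / 8) := by
    apply Real.logb_le_logb_of_le (by norm_num) (by positivity)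
    have : (b.eval : ℝ) / a.eval ≤ 1 / 8 := by
      rw [div_le_iff₀ ha]
      have : (8 * b.eval : ℝ) ≤ a.eval := by exact_mod_cast h
      linarith
    linarith
  have h2 : 6 * Real.logb 3 (9 / 8) ≤ 1 := by
    have := (Real.logb_le_iff_le_rpow (b := 3) (x := (9 / 8) ^ 6) (y := 1) (by norm_num)
      (by norm_num)).2 (by norm_num)
    rw [Real.logb_pow] at this
    exact_mod_cast this
  have h3 : (1 : ℝ) ≤ b.ones := by exact_mod_cast b.ones_pos
  rw [defect_add]
  linarith

theorem finite_defect_of_ones_le (K : ℕ) : {x : ℝ | ∃ e : OnesExpr, e.ones ≤ K ∧ e.defect = x}.Finite := by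
  refine ((Finset.finite_toSet (Finset.range (K + 1) ×ˢ Finset.range (3 ^ K + 1))).image
    (fun p : ℕ × ℕ => (p.1 : ℝ) - 3 * Real.logb 3 (p.2 : ℝ))).subset ?_
  rintro x ⟨e, he, rfl⟩
  refine ⟨(e.ones, e.eval), ?_, rfl⟩
  have := e.eval_le.trans (Nat.pow_le_pow_right (by norm_num : 0 < 3) he)
  simp only [Finset.coe_product, Set.mem_prod, Finset.mem_coe, Finset.mem_range]
  omega

theorem finite_defect_of_eval_le (N : ℕ) (r : ℝ) :
    {x : ℝ | ∃ e : OnesExpr, e.eval ≤ N ∧ e.defect < r ∧ e.defect = x}.Finite := by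
  refine (finite_defect_of_ones_le ⌈r + 3 * Real.logb 3 N⌉₊).subset ?_
  rintro x ⟨e, he, hr, rfl⟩
  refine ⟨e, ?_, rfl⟩
  have h1 : Real.logb 3 e.eval ≤ Real.logb 3 N :=
    Real.logb_le_logb_of_le (by norm_num) e.eval_pos_real (by exact_mod_cast he)
  have h2 : (e.ones : ℝ) ≤ r + 3 * Real.logb 3 N := by
    unfold defect at hr; linarith
  exact_mod_cast h2.trans (Nat.le_ceil _)

/-- Sums of bounded defect whose summands are comparable have bounded value: the defect bounds
the number of ones of the smaller summand. -/
theorem eval_add_le {a b : OnesExpr} {K : ℕ} (h : b.eval ≤ a.eval) (h8 : a.eval < 8 * b.eval)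
    (hK : (OnesExpr.add a b).defect + 2 ≤ K) : (OnesExpr.add a b).eval ≤ 9 * 3 ^ K := by
  have h1 : b.ones ≤ K := by exact_mod_cast (ones_le_defect_add h).trans hK
  have h2 := b.eval_le.trans (Nat.pow_le_pow_right (by norm_num : 0 < 3) h1)
  simp only [eval]
  omega

/-- Zero is isolated among the defects of expressions. -/
theorem exists_defect_gap : ∃ η : ℝ, 0 < η ∧ η ≤ 1 / 2 ∧ ∀ e : OnesExpr, e.defect = 0 ∨ η ≤ e.defect := by
  have hfin := finite_defect_of_eval_le (9 * 3 ^ 3) 1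
  obtain ⟨η, h0, h1, h2⟩ : ∃ η : ℝ, 0 < η ∧ η ≤ 1 / 2 ∧
      ∀ x ∈ {x : ℝ | ∃ e : OnesExpr, e.eval ≤ 9 * 3 ^ 3 ∧ e.defect < 1 ∧ e.defect = x},
        0 < x → η ≤ x := by
    generalize {x : ℝ | ∃ e : OnesExpr, e.eval ≤ 9 * 3 ^ 3 ∧ e.defect < 1 ∧ e.defect = x} = s at hfin
    induction s, hfin using Set.Finite.induction_on with
    | empty => exact ⟨1 / 2, by norm_num, le_rfl, by simp⟩
    | @insert a s _ _ ih =>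
      obtain ⟨η, h0, h1, h2⟩ := ih
      by_cases ha : 0 < a
      · refine ⟨min η a, lt_min h0 ha, (min_le_left _ _).trans h1, ?_⟩
        rintro x (rfl | hx) hx0
        · exact min_le_right _ _
        · exact (min_le_left _ _).trans (h2 x hx hx0)
      · refine ⟨η, h0, h1, ?_⟩
        rintro x (rfl | hx) hx0
        · exact absurd hx0 ha
        · exact h2 x hx hx0
  refine ⟨η, h0, h1, fun e => ?_⟩
  have hadd : ∀ a b : OnesExpr, b.eval ≤ a.eval →
      (OnesExpr.add a b).defect = 0 ∨ η ≤ (OnesExpr.add a b).defect := by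
    intro a b h
    rcases Nat.lt_or_ge a.eval (8 * b.eval) with h8 | h8
    · rcases lt_or_ge (OnesExpr.add a b).defect 1 with hd | hd
      · rcases (OnesExpr.add a b).defect_nonneg.eq_or_lt with h' | h'
        · exact .inl h'.symm
        · exact .inr (h2 _ ⟨_, eval_add_le h h8 (by push_cast; linarith), hd, rfl⟩ h')
      · exact .inr (by linarith)
    · exact .inr (by linarith [defect_add_half_le h8, a.defect_nonneg])
  induction e with
  | one => exact .inr (by rw [defect_one]; linarith)
  | add a b _ _ =>
    rcases le_total b.eval a.eval with h | h
    · exact hadd a b h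
    · rw [defect_add_comm]; exact hadd b a h
  | mul a b iha ihb =>
    rw [defect_mul]
    rcases iha with iha | iha
    · rwa [iha, zero_add]
    · exact .inr (by linarith [b.defect_nonneg])

end OnesExpr

/-! ### Limits of sequences of defects -/

/-- The closure of the set of defects of all expressions. -/
def closedDefects : Set ℝ := closure (Set.range OnesExpr.defect)

theorem defect_mem_closedDefects (e : OnesExpr) : e.defect ∈ closedDefects :=
  subset_closure ⟨e, rfl⟩

theorem closedDefects_nonneg {x : ℝ} (hx : x ∈ closedDefects) : 0 ≤ x := by
  have : closedDefects ⊆ Set.Ici 0 :=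
    closure_minimal (by rintro _ ⟨e, rfl⟩; exact e.defect_nonneg) isClosed_Ici
  exact this hx

theorem closedDefects_add {x y : ℝ} (hx : x ∈ closedDefects) (hy : y ∈ closedDefects) :
    x + y ∈ closedDefects :=
  map_mem_closure₂ continuous_add hx hy (by
    rintro _ ⟨a, rfl⟩ _ ⟨b, rfl⟩
    exact ⟨.mul a b, OnesExpr.defect_mul a b⟩)

theorem closedDefects_add_nat {x : ℝ} (hx : x ∈ closedDefects) (n : ℕ) : x + n ∈ closedDefects := by
  induction n with
  | zero => simpa using hx
  | succ n ih =>
    have := closedDefects_add ih (defect_mem_closedDefects .one)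
    rw [OnesExpr.defect_one] at this
    push_cast
    rwa [← add_assoc]

/-- The sequence `d` has a nondecreasing convergent subsequence which is constant, or whose
limit exceeds an element of `closedDefects` by exactly `1`. -/
def HasGoodSubseq (d : ℕ → ℝ) : Prop :=
  ∃ φ : ℕ → ℕ, StrictMono φ ∧ Monotone (d ∘ φ) ∧ ∃ l, Tendsto (d ∘ φ) atTop (𝓝 l) ∧
    ((∀ n, d (φ n) = l) ∨ l - 1 ∈ closedDefects)

theorem HasGoodSubseq.of_subseq {d : ℕ → ℝ} {ψ : ℕ → ℕ} (hψ : StrictMono ψ)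
    (h : HasGoodSubseq (d ∘ ψ)) : HasGoodSubseq d := by
  obtain ⟨φ, h1, h2, l, h3, h4⟩ := h
  exact ⟨ψ ∘ φ, hψ.comp h1, h2, l, h3, h4⟩

/-- Pigeonhole principle for a finite range, along a subsequence. -/
theorem exists_strictMono_const {α : Type*} {s : Set α} (hs : s.Finite) (d : ℕ → α)
    (h : ∀ n, d n ∈ s) : ∃ (c : α) (φ : ℕ → ℕ), StrictMono φ ∧ ∀ n, d (φ n) = c := by
  have : ∃ c ∈ s, ∃ᶠ n in atTop, d n = c := by
    by_contra! hc
    have : ∀ᶠ n in atTop, ∀ c ∈ s, d n ≠ c := by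
      rw [eventually_all_finite hs]
      intro c hcs
      exact hc c hcs
    obtain ⟨n, hn⟩ := this.exists
    exact hn _ (h n) rfl
  obtain ⟨c, _, hc⟩ := this
  obtain ⟨φ, h1, h2⟩ := extraction_of_frequently_atTop hc
  exact ⟨c, φ, h1, h2⟩

theorem HasGoodSubseq.of_finite {s : Set ℝ} (hs : s.Finite) {d : ℕ → ℝ} (h : ∀ n, d n ∈ s) :
    HasGoodSubseq d := by
  obtain ⟨c, φ, h1, h2⟩ := exists_strictMono_const hs d h
  have : d ∘ φ = fun _ => c := funext h2
  exact ⟨φ, h1, by rw [this]; exact monotone_const, c, by rw [this]; exact tendsto_const_nhds,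
    .inl h2⟩

theorem exists_strictMono_or {P Q : ℕ → Prop} (h : ∀ n, P n ∨ Q n) :
    ∃ φ : ℕ → ℕ, StrictMono φ ∧ ((∀ n, P (φ n)) ∨ ∀ n, Q (φ n)) := by
  by_cases hP : ∃ᶠ n in atTop, P n
  · obtain ⟨φ, h1, h2⟩ := extraction_of_frequently_atTop hP
    exact ⟨φ, h1, .inl h2⟩
  · obtain ⟨φ, h1, h2⟩ := extraction_of_eventually_atTop (not_frequently.1 hP)
    exact ⟨φ, h1, .inr fun n => (h _).resolve_left (h2 n)⟩

/-- For every sequence of expressions of defect below `r`, the defects have a good subsequence. -/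
def GoodBelow (r : ℝ) : Prop :=
  ∀ e : ℕ → OnesExpr, (∀ n, (e n).defect < r) → HasGoodSubseq fun n => (e n).defect

/-- Termwise sums of defects: limits add up, and `closedDefects` is closed under addition. -/
theorem GoodBelow.mul {r : ℝ} (hr : GoodBelow r) {d : ℕ → ℝ} {u v : ℕ → OnesExpr}
    (hd : ∀ n, d n = (u n).defect + (v n).defect)
    (hu : ∀ n, (u n).defect < r) (hv : ∀ n, (v n).defect < r) : HasGoodSubseq d := by
  obtain ⟨φ, hφ, hm, l, hl, hc⟩ := hr u hu
  obtain ⟨ψ, hψ, hm', l', hl', hc'⟩ := hr (v ∘ φ) fun n => hv _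
  have hl2 := hl.comp hψ.tendsto_atTop
  have e1 : d ∘ (φ ∘ ψ) = fun n => (u (φ (ψ n))).defect + (v (φ (ψ n))).defect :=
    funext fun n => hd _
  have hlF : l ∈ closedDefects :=
    isClosed_closure.mem_of_tendsto hl (Eventually.of_forall fun n => defect_mem_closedDefects _)
  have hlF' : l' ∈ closedDefects :=
    isClosed_closure.mem_of_tendsto hl' (Eventually.of_forall fun n => defect_mem_closedDefects _)
  refine ⟨φ ∘ ψ, hφ.comp hψ, ?_, l + l', ?_, ?_⟩
  · rw [e1]; exact (hm.comp hψ.monotone).add hm'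
  · rw [e1]; exact hl2.add hl'
  · rcases hc with hc | hc
    · rcases hc' with hc' | hc'
      · refine .inl fun n => ?_
        rw [hd]; exact congrArg₂ _ (hc _) (hc' _)
      · exact .inr (by rw [add_sub_assoc]; exact closedDefects_add hlF hc')
    · exact .inr (by rw [add_sub_right_comm]; exact closedDefects_add hc hlF')

/-- Sums with a bounded second summand: along a subsequence the second summand is constant, and
either the first one takes bounded values, which leaves finitely many defects, or it tends to
infinity, and the limit of the defects is that of the first summands plus the number of ones of
the second. -/
theorem GoodBelow.add {r K R : ℝ} (hr : GoodBelow r) {d : ℕ → ℝ} {a b : ℕ → OnesExpr}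
    (hd : ∀ n, d n = (OnesExpr.add (a n) (b n)).defect) (hR : ∀ n, d n < R)
    (ha : ∀ n, (a n).defect < r) (hb : ∀ n, ((b n).ones : ℝ) ≤ K) : HasGoodSubseq d := by
  -- The summands `b n` have finitely many pairs (value, number of ones).
  obtain ⟨⟨p, q⟩, φ₀, hφ₀, hpq⟩ := exists_strictMono_const
    (Finset.finite_toSet (Finset.range (⌊K⌋₊ + 1) ×ˢ Finset.range (3 ^ ⌊K⌋₊ + 1)))
    (fun n => ((b n).ones, (b n).eval)) (fun n => by
      have h1 : (b n).ones ≤ ⌊K⌋₊ := Nat.le_floor (hb n)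
      have := (b n).eval_le.trans (Nat.pow_le_pow_right (by norm_num : 0 < 3) h1)
      simp only [Finset.coe_product, Set.mem_prod, Finset.mem_coe, Finset.mem_range]
      omega)
  have hp : ∀ n, (b (φ₀ n)).ones = p := fun n => congrArg Prod.fst (hpq n)
  have hq : ∀ n, (b (φ₀ n)).eval = q := fun n => congrArg Prod.snd (hpq n)
  refine HasGoodSubseq.of_subseq hφ₀ ?_
  by_cases hbd : ∃ N, ∃ᶠ n in atTop, (a (φ₀ n)).eval ≤ N
  · obtain ⟨N, hN⟩ := hbd
    obtain ⟨ψ, hψ, hN⟩ := extraction_of_frequently_atTop hN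
    refine HasGoodSubseq.of_subseq hψ
      (HasGoodSubseq.of_finite (OnesExpr.finite_defect_of_eval_le (N + q) R) fun n => ?_)
    refine ⟨.add (a (φ₀ (ψ n))) (b (φ₀ (ψ n))), ?_, ?_, ?_⟩
    · simp only [OnesExpr.eval, hq]; exact Nat.add_le_add_right (hN n) _
    · rw [← hd]; exact hR _
    · exact (hd _).symm
  · push Not at hbd
    have htop : Tendsto (fun n => (a (φ₀ n)).eval) atTop atTop :=
      tendsto_atTop.2 fun N => (hbd N).mono fun n h => h.le
    obtain ⟨φ₁, hφ₁, hmono⟩ := strictMono_subseq_of_tendsto_atTop htop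
    obtain ⟨φ₂, hφ₂, hm, l, hl, -⟩ := hr (fun n => a (φ₀ (φ₁ n))) fun n => ha _
    refine HasGoodSubseq.of_subseq hφ₁ ?_
    have hlF : l ∈ closedDefects :=
      isClosed_closure.mem_of_tendsto hl (Eventually.of_forall fun n => defect_mem_closedDefects _)
    have e1 : (d ∘ φ₀) ∘ φ₁ ∘ φ₂ = fun n => (a (φ₀ (φ₁ (φ₂ n)))).defect + p -
        3 * Real.logb 3 (1 + q / (a (φ₀ (φ₁ (φ₂ n)))).eval) := by
      funext n
      simp only [Function.comp, hd, OnesExpr.defect_add, hp, hq]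
    have hev : Tendsto (fun n => ((a (φ₀ (φ₁ (φ₂ n)))).eval : ℝ)) atTop atTop :=
      tendsto_natCast_atTop_atTop.comp
        (htop.comp (hφ₁.tendsto_atTop.comp hφ₂.tendsto_atTop))
    refine ⟨φ₂, hφ₂, ?_, l + p, ?_, .inr ?_⟩
    · change Monotone ((d ∘ φ₀) ∘ φ₁ ∘ φ₂)
      rw [e1]
      intro i j hij
      have h1 : ((a (φ₀ (φ₁ (φ₂ i)))).eval : ℝ) ≤ (a (φ₀ (φ₁ (φ₂ j)))).eval := by
        exact_mod_cast hmono.monotone (hφ₂.monotone hij)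
      have h2 : Real.logb 3 (1 + q / (a (φ₀ (φ₁ (φ₂ j)))).eval) ≤
          Real.logb 3 (1 + q / (a (φ₀ (φ₁ (φ₂ i)))).eval) := by
        have := (a (φ₀ (φ₁ (φ₂ i)))).eval_pos_real
        have := (a (φ₀ (φ₁ (φ₂ j)))).eval_pos_real
        apply Real.logb_le_logb_of_le (by norm_num) (by positivity)
        gcongr
      have h3 := hm hij
      simp only [Function.comp] at h3 ⊢
      linarith
    · change Tendsto ((d ∘ φ₀) ∘ φ₁ ∘ φ₂) _ _
      rw [e1]
      have h1 : Tendsto (fun n => 1 + (q : ℝ) / (a (φ₀ (φ₁ (φ₂ n)))).eval) atTop (𝓝 (1 + 0)) :=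
        tendsto_const_nhds.add (hev.const_div_atTop _)
      rw [add_zero] at h1
      have h2 := (h1.logb (b := 3) one_ne_zero).const_mul 3
      rw [Real.logb_one, mul_zero] at h2
      simpa using (hl.add (tendsto_const_nhds (x := (p : ℝ)))).sub h2
    · have hp1 : 1 ≤ p := hp 0 ▸ (b (φ₀ 0)).ones_pos
      have := closedDefects_add_nat hlF (p - 1)
      rw [Nat.cast_sub hp1, Nat.cast_one] at this
      rwa [add_sub_assoc]

/-- The bound `r` can be raised by the gap `η` above the defect `0`: a product can be assumed to
have both factors of defect at least `η`, and in a sum that is not among finitely many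
exceptions the larger summand has defect smaller by at least `1 / 2`. -/
theorem GoodBelow.step {η r : ℝ} (hη0 : 0 < η) (hη : η ≤ 1 / 2)
    (hgap : ∀ e : OnesExpr, e.defect = 0 ∨ η ≤ e.defect) (hr : GoodBelow r) :
    GoodBelow (r + η) := by
  intro e he
  obtain ⟨K, hK⟩ := exists_nat_ge (r + η + 3)
  -- Expressions with the fewest ones among those of a given defect have no factor of defect zero.
  have key : ∀ n, ((e n).defect ∈ {x : ℝ | ∃ e : OnesExpr, e.eval ≤ 9 * 3 ^ K ∧
        e.defect < r + η ∧ e.defect = x} ∨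
      (∃ u v : OnesExpr, (e n).defect = u.defect + v.defect ∧ u.defect < r ∧ v.defect < r)) ∨
      (∃ a b : OnesExpr, (e n).defect = (OnesExpr.add a b).defect ∧ a.defect < r ∧
        (b.ones : ℝ) ≤ K) := by
    intro n
    obtain ⟨f, hf, hmin⟩ : ∃ f : OnesExpr, f.defect = (e n).defect ∧
        ∀ g : OnesExpr, g.defect = (e n).defect → f.ones ≤ g.ones := by
      obtain ⟨_, ⟨f, hf, rfl⟩, hmin⟩ := exists_minimal_of_wellFoundedLT
        (fun k => ∃ g : OnesExpr, g.defect = (e n).defect ∧ g.ones = k) ⟨_, e n, rfl, rfl⟩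
      exact ⟨f, hf, fun g hg => by
        by_contra hlt
        exact hlt (hmin ⟨g, hg, rfl⟩ (not_le.1 hlt).le)⟩
    have hlt := he n
    have hadd : ∀ a b : OnesExpr, b.eval ≤ a.eval → (OnesExpr.add a b).defect = (e n).defect →
      ((e n).defect ∈ {x : ℝ | ∃ e : OnesExpr, e.eval ≤ 9 * 3 ^ K ∧
        e.defect < r + η ∧ e.defect = x} ∨
      (∃ u v : OnesExpr, (e n).defect = u.defect + v.defect ∧ u.defect < r ∧ v.defect < r)) ∨
      (∃ a b : OnesExpr, (e n).defect = (OnesExpr.add a b).defect ∧ a.defect < r ∧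
        (b.ones : ℝ) ≤ K) := by
      intro a b hba h
      rcases Nat.lt_or_ge a.eval (8 * b.eval) with h8 | h8
      · exact .inl (.inl ⟨_, OnesExpr.eval_add_le hba h8 (by linarith), by linarith, h⟩)
      · exact .inr ⟨a, b, h.symm, by linarith [OnesExpr.defect_add_half_le h8],
          by linarith [OnesExpr.ones_le_defect_add hba]⟩
    rw [← hf] at hmin
    cases f with
    | one =>
      exact .inl (.inl ⟨.one, Nat.mul_pos (by norm_num) (pow_pos (by norm_num) _), by linarith, hf⟩)
    | add a b =>
      rcases le_total b.eval a.eval with h | h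
      · exact hadd a b h hf
      · exact hadd b a h (by rw [OnesExpr.defect_add_comm, hf])
    | mul a b =>
      have ha := hgap a
      have hb := hgap b
      have h1 := a.ones_pos
      have h2 := b.ones_pos
      simp only [OnesExpr.defect_mul, OnesExpr.ones] at hmin hf
      rcases ha with ha | ha
      · have := hmin b (by rw [ha, zero_add]); omega
      · rcases hb with hb | hb
        · have := hmin a (by rw [hb, add_zero]); omega
        · exact .inl (.inr ⟨a, b, hf.symm, by linarith, by linarith⟩)
  obtain ⟨φ, hφ, h | h⟩ := exists_strictMono_or key
  · refine HasGoodSubseq.of_subseq hφ ?_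
    obtain ⟨ψ, hψ, h | h⟩ := exists_strictMono_or h
    · exact HasGoodSubseq.of_subseq hψ
        (HasGoodSubseq.of_finite (OnesExpr.finite_defect_of_eval_le _ _) h)
    · choose u v hd hu hv using h
      exact HasGoodSubseq.of_subseq hψ (hr.mul hd hu hv)
  · choose a b hd ha hb using h
    exact HasGoodSubseq.of_subseq hφ (hr.add hd (fun n => he _) ha hb)

theorem goodBelow (r : ℝ) : GoodBelow r := by
  obtain ⟨η, h0, h1, h2⟩ := OnesExpr.exists_defect_gap
  have : ∀ m : ℕ, GoodBelow (m * η) := by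
    intro m
    induction m with
    | zero =>
      intro e he
      have := he 0
      simp only [Nat.cast_zero, zero_mul] at this
      exact absurd this (not_lt.2 (e 0).defect_nonneg)
    | succ m ih =>
      have := ih.step h0 h1 h2
      rwa [show ((m + 1 : ℕ) : ℝ) * η = m * η + η by push_cast; ring]
  obtain ⟨m, hm⟩ := exists_nat_ge (r / η)
  exact fun e he => this m e fun n => (he n).trans_le ((div_le_iff₀ h0).1 hm)

/-- The set `closedDefects` is well-ordered. -/
theorem not_strictAnti_closedDefects {z : ℕ → ℝ} (hz : ∀ n, z n ∈ closedDefects) :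
    ¬ StrictAnti z := by
  intro ha
  have : ∀ n, ∃ e : OnesExpr, e.defect ∈ Set.Ioo (z (2 * n + 2)) (z (2 * n)) := by
    intro n
    obtain ⟨_, h, ⟨e, rfl⟩⟩ := mem_closure_iff.1 (hz (2 * n + 1))
      (Set.Ioo (z (2 * n + 2)) (z (2 * n))) isOpen_Ioo
      ⟨ha (by omega), ha (by omega)⟩
    exact ⟨e, h⟩
  choose e he using this
  have hlt : ∀ n, (e n).defect < z 0 := fun n => (he n).2.trans_le (ha.antitone (by omega))
  obtain ⟨φ, hφ, hm, -⟩ := goodBelow _ e hlt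
  have h1 := hm (Nat.zero_le 1)
  have h2 := hφ zero_lt_one
  have h3 : z (2 * φ 1) ≤ z (2 * φ 0 + 2) := ha.antitone (by omega)
  simp only [Function.comp] at h1
  linarith [(he (φ 0)).1, (he (φ 1)).2]

/-- Limit points of `closedDefects` lie in `1 + closedDefects`. This bounds the order type from
above. -/
theorem sub_one_mem_of_strictMono {z : ℕ → ℝ} (hz : ∀ n, z n ∈ closedDefects)
    (hm : StrictMono z) {w : ℝ} (hw : Tendsto z atTop (𝓝 w)) : w - 1 ∈ closedDefects := by
  -- Interleave a sequence of defects of expressions with `z`.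
  have : ∀ n, ∃ e : OnesExpr, e.defect ∈ Set.Ioo (z (2 * n)) (z (2 * n + 2)) := by
    intro n
    obtain ⟨_, h, ⟨e, rfl⟩⟩ := mem_closure_iff.1 (hz (2 * n + 1))
      (Set.Ioo (z (2 * n)) (z (2 * n + 2))) isOpen_Ioo
      ⟨hm (by omega), hm (by omega)⟩
    exact ⟨e, h⟩
  choose e he using this
  have hle : ∀ n, z n ≤ w := fun n => hm.monotone.ge_of_tendsto hw n
  obtain ⟨φ, hφ, -, l, hl, hc⟩ := goodBelow w e fun n => (he n).2.trans_le (hle _)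
  have hlw : l = w := by
    refine tendsto_nhds_unique hl (tendsto_of_tendsto_of_tendsto_of_le_of_le
      (hw.comp hφ.tendsto_atTop) tendsto_const_nhds (fun n => ?_) fun n => ?_)
    · exact (hm.monotone (by omega)).trans (he (φ n)).1.le
    · exact (he (φ n)).2.le.trans (hle _)
  rcases hc with hc | hc
  · have h1 := hc 0
    rw [hlw] at h1
    linarith [(he (φ 0)).2, hle (2 * φ 0 + 2)]
  · rwa [hlw] at hc

/-! ### The upper bound for order types -/

open Ordinal in
/-- A weakly increasing function to ordinals below `ω ^ k` that increases strictly whenever it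
reaches a point of `closedDefects ∩ (-∞, k)`. In the inductive step `φ (y - 1)` counts the limit
points up to `y`, since these lie in `1 + closedDefects`; the points of `closedDefects` at which
this count is the same are finite in number. -/
theorem exists_rank (k : ℕ) : ∃ φ : ℝ → Ordinal.{0}, (∀ x < (k : ℝ), φ x < ω ^ k) ∧
    (∀ x y, x ≤ y → y < (k : ℝ) → φ x ≤ φ y) ∧
    (∀ x y, x < y → y < (k : ℝ) → y ∈ closedDefects → φ x < φ y) := by
  induction k with
  | zero =>
    refine ⟨fun _ => 0, fun x _ => by simp, fun x y _ _ => le_rfl, fun x y _ hy hF => ?_⟩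
    have := closedDefects_nonneg hF
    rw [Nat.cast_zero] at hy
    linarith
  | succ k ih =>
    obtain ⟨φ, h1, h2, h3⟩ := ih
    have hsub : ∀ y, y < ((k + 1 : ℕ) : ℝ) → y - 1 < (k : ℝ) := fun y hy => by
      push_cast at hy; linarith
    let A : ℝ → Set ℝ := fun y => {z | z ∈ closedDefects ∧ z ≤ y ∧ φ (z - 1) = φ (y - 1)}
    have hfin : ∀ y, y < ((k + 1 : ℕ) : ℝ) → (A y).Finite := by
      intro y hy
      by_contra hinf
      have : Infinite (A y) := Set.infinite_coe_iff.2 hinf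
      obtain ⟨f, hf | hf⟩ := Infinite.exists_strictMono_or_strictAnti (A y)
      · have hm : StrictMono fun n => (f n : ℝ) := fun i j hij => hf hij
        have hbdd : BddAbove (Set.range fun n => (f n : ℝ)) :=
          ⟨y, by rintro _ ⟨n, rfl⟩; exact (f n).2.2.1⟩
        have hw := tendsto_atTop_ciSup hm.monotone hbdd
        set w := ⨆ n, (f n : ℝ)
        have hwF := sub_one_mem_of_strictMono (fun n => (f n).2.1) hm hw
        have hwy : w ≤ y := ciSup_le fun n => (f n).2.2.1
        have hlt : (f 0 : ℝ) < w := (hm zero_lt_one).trans_le (le_ciSup hbdd 1)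
        have h4 := h3 ((f 0 : ℝ) - 1) (w - 1) (by linarith) (by linarith [hsub y hy]) hwF
        have h5 := h2 (w - 1) (y - 1) (by linarith) (hsub y hy)
        exact absurd (f 0).2.2.2 (h4.trans_le h5).ne
      · exact not_strictAnti_closedDefects (fun n => (f n).2.1) (fun i j hij => hf hij)
    have hlt : ∀ y (n : ℕ), ω * φ y + n < ω * (φ y + 1) := fun y n => by
      rw [mul_add_one]; exact (add_lt_add_iff_left _).2 (natCast_lt_omega0 n)
    have hstep : ∀ x y (n m : ℕ), φ x < φ y → ω * φ x + n < ω * φ y + m := fun x y n m h =>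
      (hlt x n).trans_le ((mul_le_mul_right (Order.add_one_le_of_lt h) ω).trans le_self_add)
    refine ⟨fun y => ω * φ (y - 1) + ((A y).ncard : ℕ), fun x hx => ?_, fun x y hxy hy => ?_,
      fun x y hxy hy hF => ?_⟩
    · rw [pow_succ']
      exact (hlt _ _).trans_le (mul_le_mul_right (Order.add_one_le_of_lt (h1 _ (hsub x hx))) ω)
    · rcases (h2 (x - 1) (y - 1) (by linarith) (hsub y hy)).lt_or_eq with h | h
      · exact (hstep _ _ _ _ h).le
      · have hA : A x ⊆ A y := fun z hz => ⟨hz.1, hz.2.1.trans hxy, hz.2.2.trans h⟩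
        dsimp only
        rw [h]
        gcongr
        exact hfin y hy
    · rcases (h2 (x - 1) (y - 1) (by linarith) (hsub y hy)).lt_or_eq with h | h
      · exact hstep _ _ _ _ h
      · have hA : A x ⊂ A y := by
          have hsubset : A x ⊆ A y := fun z hz => ⟨hz.1, hz.2.1.trans hxy.le, hz.2.2.trans h⟩
          refine (Set.ssubset_iff_of_subset hsubset).2 ⟨y, ⟨hF, le_rfl, rfl⟩, fun hy' => ?_⟩
          exact absurd hy'.2.1 (not_le.2 hxy)
        dsimp only
        rw [h]
        refine (add_lt_add_iff_left _).2 ?_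
        exact_mod_cast Set.ncard_lt_ncard hA (hfin y hy)

/-! ### Sets of order type at least `ω ^ k` -/

/-- A set of reals that contains, in the inductive sense of `k` times iterated increasing
sequences of sets, a set of order type at least `ω ^ k`. -/
def OmegaPowLarge : ℕ → Set ℝ → Prop
  | 0, S => S.Nonempty
  | k + 1, S => ∃ T : ℕ → Set ℝ, (∀ i, T i ⊆ S ∧ OmegaPowLarge k (T i)) ∧
      ∀ i j, i < j → ∀ x ∈ T i, ∀ y ∈ T j, x < y

namespace OmegaPowLarge

theorem mono {k : ℕ} {S S' : Set ℝ} (h : OmegaPowLarge k S) (hs : S ⊆ S') :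
    OmegaPowLarge k S' := by
  cases k with
  | zero => exact Set.Nonempty.mono hs h
  | succ k =>
    obtain ⟨T, h1, h2⟩ := h
    exact ⟨T, fun i => ⟨(h1 i).1.trans hs, (h1 i).2⟩, h2⟩

theorem nonempty {k : ℕ} {S : Set ℝ} (h : OmegaPowLarge k S) : S.Nonempty := by
  induction k generalizing S with
  | zero => exact h
  | succ k ih =>
    obtain ⟨T, h1, -⟩ := h
    exact (ih (h1 0).2).mono (h1 0).1

/-- Indecomposability of `ω ^ k`. -/
theorem of_union {k : ℕ} {A B : Set ℝ} (h : OmegaPowLarge k (A ∪ B)) :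
    OmegaPowLarge k A ∨ OmegaPowLarge k B := by
  induction k generalizing A B with
  | zero => exact Set.union_nonempty.1 h
  | succ k ih =>
    obtain ⟨T, h1, h2⟩ := h
    have : ∀ i, OmegaPowLarge k (A ∩ T i) ∨ OmegaPowLarge k (B ∩ T i) := fun i => by
      refine ih ((h1 i).2.mono fun x hx => ?_)
      rw [← Set.union_inter_distrib_right]
      exact ⟨(h1 i).1 hx, hx⟩
    obtain ⟨φ, hφ, h | h⟩ := exists_strictMono_or this
    · exact .inl ⟨fun i => A ∩ T (φ i), fun i => ⟨Set.inter_subset_left, h i⟩,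
        fun i j hij x hx y hy => h2 _ _ (hφ hij) x hx.2 y hy.2⟩
    · exact .inr ⟨fun i => B ∩ T (φ i), fun i => ⟨Set.inter_subset_left, h i⟩,
        fun i j hij x hx y hy => h2 _ _ (hφ hij) x hx.2 y hy.2⟩

theorem translate {k : ℕ} {S : Set ℝ} (h : OmegaPowLarge k S) (c : ℝ) :
    OmegaPowLarge k ((· - c) '' S) := by
  induction k generalizing S with
  | zero => exact h.image _
  | succ k ih =>
    obtain ⟨T, h1, h2⟩ := h
    refine ⟨fun i => (· - c) '' T i, fun i => ⟨Set.image_mono (h1 i).1, ih (h1 i).2⟩, ?_⟩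
    rintro i j hij _ ⟨x, hx, rfl⟩ _ ⟨y, hy, rfl⟩
    exact sub_lt_sub_right (h2 i j hij x hx y hy) c

/-- If finitely many translates of `D` cover a large set, then `D` is large. -/
theorem of_iUnion_translate {k m : ℕ} {S D : Set ℝ} (h : OmegaPowLarge k S)
    (hS : ∀ x ∈ S, ∃ i < m, x - (i : ℝ) ∈ D) : OmegaPowLarge k D := by
  induction m generalizing S with
  | zero =>
    obtain ⟨x, hx⟩ := h.nonempty
    obtain ⟨i, hi, -⟩ := hS x hx
    omega
  | succ m ih =>
    have : S = {x ∈ S | x - (m : ℝ) ∈ D} ∪ {x ∈ S | x - (m : ℝ) ∉ D} := by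
      ext x; simp only [Set.mem_union, Set.mem_ofPred_eq]; tauto
    rw [this] at h
    rcases h.of_union with h | h
    · refine (h.translate m).mono ?_
      rintro _ ⟨x, hx, rfl⟩
      exact hx.2
    · refine ih h fun x hx => ?_
      obtain ⟨i, hi, hD⟩ := hS x hx.1
      refine ⟨i, lt_of_le_of_ne (by omega) ?_, hD⟩
      rintro rfl
      exact hx.2 hD

open Ordinal in
/-- Strictly increasing ordinal-valued functions grow by at least `ω ^ k` on a large set. The
offset `α` makes the induction work. -/
theorem exists_le {k : ℕ} {S : Set ℝ} (h : OmegaPowLarge k S) {φ : ℝ → Ordinal.{0}}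
    (hφ : StrictMonoOn φ S) {α : Ordinal.{0}} (hα : ∀ x ∈ S, α ≤ φ x) {β : Ordinal.{0}}
    (hβ : β < ω ^ k) : ∃ x ∈ S, α + β ≤ φ x := by
  induction k generalizing S α β with
  | zero =>
    obtain ⟨x, hx⟩ := h
    have : β = 0 := by simpa using hβ
    exact ⟨x, hx, by rw [this, add_zero]; exact hα x hx⟩
  | succ k ih =>
    obtain ⟨T, h1, h2⟩ := h
    have key : ∀ i : ℕ, ∀ x ∈ T i, α + ω ^ k * i ≤ φ x := by
      intro i
      induction i with
      | zero => intro x hx; simpa using hα x ((h1 0).1 hx)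
      | succ i hi =>
        intro x hx
        rw [Nat.cast_succ, mul_add_one, ← add_assoc]
        by_contra! hlt
        obtain ⟨d, hd, hle⟩ := (lt_add_iff (pow_ne_zero _ omega0_ne_zero)).1 hlt
        obtain ⟨y, hy, hdy⟩ := ih (h1 i).2 (hφ.mono (h1 i).1) hi hd
        have := hφ ((h1 i).1 hy) ((h1 (i + 1)).1 hx) (h2 i (i + 1) (by omega) y hy x hx)
        exact absurd (hle.trans hdy) (not_le.2 this)
    rw [pow_succ] at hβ
    obtain ⟨c, hc, hβ⟩ := (lt_mul_iff_of_isSuccLimit isSuccLimit_omega0).1 hβ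
    obtain ⟨m, rfl⟩ := lt_omega0.1 hc
    obtain ⟨x, hx⟩ := (h1 m).2.nonempty
    exact ⟨x, (h1 m).1 hx, (add_le_add_right hβ.le α).trans (key m x hx)⟩

end OmegaPowLarge

/-! ### A large set of defects of expressions -/

/-- The expression for `e · 3 ^ d` that uses `3 d` further ones. -/
def OnesExpr.mulThreePow (e : OnesExpr) : ℕ → OnesExpr
  | 0 => e
  | d + 1 => .mul (e.mulThreePow d) (.add (.add .one .one) .one)

theorem OnesExpr.eval_mulThreePow (e : OnesExpr) (d : ℕ) :
    (e.mulThreePow d).eval = e.eval * 3 ^ d := by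
  induction d with
  | zero => simp [mulThreePow]
  | succ d ih => simp only [mulThreePow, eval, ih]; ring

theorem OnesExpr.ones_mulThreePow (e : OnesExpr) (d : ℕ) :
    (e.mulThreePow d).ones = e.ones + 3 * d := by
  induction d with
  | zero => simp [mulThreePow]
  | succ d ih => simp only [mulThreePow, ones, ih]; ring

/-- Iterating `e ↦ e * 3 ^ d + 1` exactly `k` times, with all `d ≥ 1`, yields an `ω ^ k`-large set
of defects: up to the powers of `3`, the value moves from `e` to at most `e + 1 / 2`, so that
the ranges belonging to different first exponents `d` are disjoint and move up with `d`. -/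
theorem omegaPowLarge_range_defect (k : ℕ) (e : OnesExpr) :
    OmegaPowLarge k (Set.range OnesExpr.defect ∩
      Set.Icc (e.ones + k - 3 * Real.logb 3 (e.eval + 1 / 2))
        (e.ones + k - 3 * Real.logb 3 e.eval)) := by
  induction k generalizing e with
  | zero =>
    refine ⟨e.defect, ⟨e, rfl⟩, ?_, ?_⟩
    · have := e.eval_pos_real
      have := Real.logb_le_logb_of_le (b := 3) (by norm_num) this
        (by linarith : (e.eval : ℝ) ≤ e.eval + 1 / 2)
      simp only [OnesExpr.defect, Nat.cast_zero]
      linarith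
    · simp [OnesExpr.defect]
  | succ k ih =>
    let f : ℕ → OnesExpr := fun d => .add (e.mulThreePow (d + 1)) .one
    have he := e.eval_pos_real
    have hev : ∀ d c, (((f d).eval : ℕ) : ℝ) + c = (e.eval + (1 + c) / 3 ^ (d + 1)) * 3 ^ (d + 1) := by
      intro d c
      simp only [f, OnesExpr.eval, OnesExpr.eval_mulThreePow]
      push_cast
      field_simp
      ring
    have hlog : ∀ d (c : ℝ), 0 ≤ c → (((f d).ones : ℕ) : ℝ) + k - 3 * Real.logb 3 ((f d).eval + c)
        = e.ones + (k + 1 : ℕ) - 3 * Real.logb 3 (e.eval + (1 + c) / 3 ^ (d + 1)) := by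
      intro d c hc
      rw [hev, Real.logb_mul (by positivity) (by positivity), Real.logb_pow,
        Real.logb_self_eq_one (by norm_num)]
      simp only [f, OnesExpr.ones, OnesExpr.ones_mulThreePow]
      push_cast
      ring
    have hlog0 := fun d => hlog d 0 le_rfl
    simp only [add_zero] at hlog0
    refine ⟨_, fun d => ⟨Set.inter_subset_inter_right _ ?_, ih (f d)⟩, ?_⟩
    · rw [hlog0, hlog _ _ (by norm_num)]
      have h3 : (3 : ℝ) ≤ 3 ^ (d + 1) := le_self_pow₀ (by norm_num) (by omega)
      have hq : (1 + 1 / 2 : ℝ) / 3 ^ (d + 1) ≤ 1 / 2 := by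
        rw [div_le_div_iff₀ (by positivity) (by norm_num)]
        linarith
      have hq0 : (0 : ℝ) ≤ 1 / 3 ^ (d + 1) := by positivity
      apply Set.Icc_subset_Icc
      · have := Real.logb_le_logb_of_le (b := 3) (by norm_num) (by positivity)
          (by linarith : (e.eval : ℝ) + (1 + 1 / 2) / 3 ^ (d + 1) ≤ e.eval + 1 / 2)
        linarith
      · have := Real.logb_le_logb_of_le (b := 3) (by norm_num) he
          (by linarith : (e.eval : ℝ) ≤ e.eval + 1 / 3 ^ (d + 1))
        linarith
    · rintro i j hij x ⟨-, -, hx⟩ y ⟨-, hy, -⟩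
      refine hx.trans_lt (lt_of_lt_of_le ?_ hy)
      rw [hlog0, hlog _ _ (by norm_num)]
      have h3 : (3 : ℝ) * 3 ^ (i + 1) ≤ 3 ^ (j + 1) := by
        rw [← pow_succ']; exact pow_le_pow_right₀ (by norm_num) (by omega)
      have hi : (0 : ℝ) < 3 ^ (i + 1) := by positivity
      have hq : (1 + 1 / 2 : ℝ) / 3 ^ (j + 1) < 1 / 3 ^ (i + 1) := by
        rw [div_lt_div_iff₀ (by positivity) (by positivity)]
        linarith
      have := Real.logb_lt_logb (b := 3) (by norm_num) (by positivity)
        (by linarith : (e.eval : ℝ) + (1 + 1 / 2) / 3 ^ (j + 1) < e.eval + 1 / 3 ^ (i + 1))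
      linarith

/-! ### Defects of integers -/

theorem integerComplexity_le (e : OnesExpr) : integerComplexity e.eval ≤ e.ones :=
  Nat.sInf_le ⟨e, rfl, rfl⟩

theorem exists_optimal {n : ℕ} (hn : 1 ≤ n) :
    ∃ e : OnesExpr, e.eval = n ∧ e.ones = integerComplexity n := by
  obtain ⟨e, he⟩ := OnesExpr.exists_eval_eq n hn
  exact Nat.sInf_mem (s := {k : ℕ | ∃ e : OnesExpr, e.eval = n ∧ e.ones = k}) ⟨_, e, he, rfl⟩

theorem defectSet_subset_range : defectSet ⊆ Set.range OnesExpr.defect := by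
  rintro _ ⟨n, hn, rfl⟩
  obtain ⟨e, he, ho⟩ := exists_optimal hn
  exact ⟨e, by rw [OnesExpr.defect, defect, he, ho]⟩

theorem defectSet_subset_closedDefects : defectSet ⊆ closedDefects :=
  defectSet_subset_range.trans subset_closure

theorem defectSet_nonneg {x : ℝ} (hx : x ∈ defectSet) : 0 ≤ x :=
  closedDefects_nonneg (defectSet_subset_closedDefects hx)

/-- The defect of an expression exceeds the defect of its value by a natural number, so
finitely many translates of `defectSet` cover the large set of defects of expressions. -/
theorem omegaPowLarge_defectSet {k : ℕ} (hk : 1 ≤ k) :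
    OmegaPowLarge k (defectSet ∩ Set.Ico (0 : ℝ) k) := by
  -- Starting from an expression for `3`, of defect `0`, all defects produced are below `k`.
  let three : OnesExpr := .add (.add .one .one) .one
  have h := omegaPowLarge_range_defect k three
  have hS : OmegaPowLarge k (Set.range OnesExpr.defect ∩ Set.Iio (k : ℝ)) := by
    obtain ⟨k, rfl⟩ : ∃ j, k = j + 1 := ⟨k - 1, by omega⟩
    obtain ⟨T, h1, h2⟩ := h
    refine ⟨T, fun i => ⟨fun x hx => ⟨((h1 i).1 hx).1, ?_⟩, (h1 i).2⟩, h2⟩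
    obtain ⟨y, hy⟩ := (h1 (i + 1)).2.nonempty
    have h3 := ((h1 (i + 1)).1 hy).2.2
    have h4 := h2 i (i + 1) (by omega) x hx y hy
    simp only [three, OnesExpr.ones, OnesExpr.eval] at h3
    norm_num at h3
    simp only [Set.mem_Iio]
    push_cast
    linarith
  refine hS.of_iUnion_translate (m := k) ?_
  rintro _ ⟨⟨e, rfl⟩, he⟩
  have h1 := integerComplexity_le e
  have hD : defect e.eval ∈ defectSet := ⟨e.eval, e.eval_pos, rfl⟩
  have heq : e.defect - ((e.ones - integerComplexity e.eval : ℕ) : ℝ) = defect e.eval := by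
    rw [Nat.cast_sub h1, OnesExpr.defect, defect]; ring
  have h0 := defectSet_nonneg hD
  simp only [Set.mem_Iio] at he
  refine ⟨e.ones - integerComplexity e.eval, ?_, ?_⟩
  · have : ((e.ones - integerComplexity e.eval : ℕ) : ℝ) < k := by linarith
    exact_mod_cast this
  · rw [heq]
    refine ⟨hD, h0, ?_⟩
    have : (0 : ℝ) ≤ ((e.ones - integerComplexity e.eval : ℕ) : ℝ) := Nat.cast_nonneg _
    linarith

theorem zero_mem_defectSet : (0 : ℝ) ∈ defectSet := by
  have h := integerComplexity_le (.add (.add .one .one) .one)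
  have h0 := defectSet_nonneg ⟨3, by norm_num, rfl⟩
  simp only [OnesExpr.eval, OnesExpr.ones] at h
  have h' : (integerComplexity 3 : ℝ) ≤ 3 := by exact_mod_cast h
  refine ⟨3, by norm_num, le_antisymm ?_ h0⟩
  simp only [defect]
  norm_num
  exact_mod_cast h'

theorem defect_one_eq : defect 1 = 1 := by
  have h := integerComplexity_le .one
  obtain ⟨e, -, he⟩ := exists_optimal le_rfl
  have := e.ones_pos
  simp only [OnesExpr.eval, OnesExpr.ones] at h
  have : integerComplexity 1 = 1 := by omega
  simp [defect, this]

/-- An integral defect belongs to a power of `3`, hence is `0` or `1`. -/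
theorem natCast_notMem_defectSet {k : ℕ} (hk : 2 ≤ k) : (k : ℝ) ∉ defectSet := by
  rintro ⟨n, hn, h⟩
  have hk' : (2 : ℝ) ≤ k := by exact_mod_cast hk
  have h0 : (0 : ℝ) < n := by exact_mod_cast hn
  have h1 : Real.logb 3 ((n : ℝ) ^ 3) = (integerComplexity n : ℝ) - k := by
    rw [Real.logb_pow, ← h, defect]; push_cast; ring
  have hlog0 : 0 ≤ Real.logb 3 (n : ℝ) := Real.logb_nonneg (by norm_num) (by exact_mod_cast hn)
  have hle : k ≤ integerComplexity n := by
    have : (k : ℝ) ≤ integerComplexity n := by rw [← h, defect]; linarith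
    exact_mod_cast this
  rw [← Nat.cast_sub hle, Real.logb_eq_iff_rpow_eq (by norm_num) (by norm_num) (by positivity),
    Real.rpow_natCast] at h1
  have h2 : n ^ 3 = 3 ^ (integerComplexity n - k) := by exact_mod_cast h1.symm
  obtain ⟨i, -, rfl⟩ := (Nat.dvd_prime_pow Nat.prime_three).1 (h2 ▸ dvd_pow_self n (by norm_num) :
    n ∣ 3 ^ (integerComplexity n - k))
  rcases i with _ | i
  · rw [pow_zero, defect_one_eq] at h
    linarith
  · have := integerComplexity_le ((OnesExpr.add (.add .one .one) .one).mulThreePow i)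
    rw [OnesExpr.eval_mulThreePow, OnesExpr.ones_mulThreePow] at this
    simp only [OnesExpr.eval, OnesExpr.ones] at this
    rw [show (1 + 1 + 1) * 3 ^ i = 3 ^ (i + 1) by ring] at this
    have h3 : (integerComplexity (3 ^ (i + 1)) : ℝ) ≤ 1 + 1 + 1 + 3 * i := by exact_mod_cast this
    rw [defect] at h
    push_cast at h
    rw [Real.logb_pow, Real.logb_self_eq_one (by norm_num)] at h
    push_cast at h
    linarith

/-! ### Order types -/

/-- Order types of subsets of `closedDefects` computed from above by strictly increasing functions on
initial segments, and from below by the growth of all strictly increasing functions. -/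
theorem isWellOrderedOfType_of {S : Set ℝ} {o : Ordinal.{0}} (hS : S ⊆ closedDefects)
    (hle : ∀ a ∈ S, ∃ φ : ℝ → Ordinal.{0}, StrictMonoOn φ (S ∩ Set.Iic a) ∧ φ a < o)
    (hge : ∀ φ : ℝ → Ordinal.{0}, StrictMonoOn φ S → ∀ β < o, ∃ x ∈ S, β ≤ φ x) :
    IsWellOrderedOfType S o := by
  have hwf : WellFounded fun x y : S => x < y := by
    rw [RelEmbedding.wellFounded_iff_isEmpty]
    refine ⟨fun f => not_strictAnti_closedDefects (fun n => hS (f n).2) fun i j hij => ?_⟩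
    exact f.map_rel_iff.2 hij
  have : WellFoundedLT S := ⟨hwf⟩
  have hwo : IsWellOrder S (fun x y : S => x < y) := isWellOrder_lt
  refine ⟨hwo, le_antisymm (le_of_not_gt fun hlt => ?_) (le_of_not_gt fun hlt => ?_)⟩
  · obtain ⟨a, ha⟩ := Ordinal.typein_surj _ hlt
    obtain ⟨φ, hφ, hφa⟩ := hle a a.2
    have key : ∀ x : S, x ≤ a → Ordinal.typein (fun x y : S => x < y) x ≤ φ x := by
      intro x
      induction x using hwf.induction with
      | _ x ih =>
        intro hxa
        by_contra! hlt
        obtain ⟨y, hy⟩ := Ordinal.typein_surj (fun x y : S => x < y)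
          (hlt.trans (Ordinal.typein_lt_type _ x))
        have hyx : y < x := (Ordinal.typein_lt_typein (fun x y : S => x < y)).1 (hy ▸ hlt)
        have h1 := ih y hyx (hyx.le.trans hxa)
        rw [hy] at h1
        exact absurd h1 (not_le.2 (hφ ⟨y.2, hyx.le.trans hxa⟩ ⟨x.2, hxa⟩ hyx))
    have := key a le_rfl
    rw [ha] at this
    exact absurd hφa (not_lt.2 this)
  · classical
    obtain ⟨x, hx, h⟩ := hge
      (fun x => if hx : x ∈ S then Ordinal.typein (fun x y : S => x < y) ⟨x, hx⟩ else 0)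
      (fun x hx y hy hxy => by
        simp only [dif_pos hx, dif_pos hy]
        exact (Ordinal.typein_lt_typein (fun x y : S => x < y)).2 hxy) _ hlt
    simp only [dif_pos hx] at h
    exact absurd h (not_le.2 (Ordinal.typein_lt_type _ _))

open Ordinal in
theorem isWellOrderedOfType_Ico {k : ℕ} (hk : 1 ≤ k) :
    IsWellOrderedOfType (defectSet ∩ Set.Ico (0 : ℝ) k) (ω ^ k) := by
  refine isWellOrderedOfType_of (Set.inter_subset_left.trans defectSet_subset_closedDefects) ?_ ?_
  · obtain ⟨φ, h1, -, h3⟩ := exists_rank k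
    exact fun a ha => ⟨φ, fun x hx y hy hxy =>
      h3 x y hxy hy.1.2.2 (defectSet_subset_closedDefects hy.1.1), h1 a ha.2.2⟩
  · intro φ hφ β hβ
    obtain ⟨x, hx, h⟩ := (omegaPowLarge_defectSet hk).exists_le hφ (fun _ _ => zero_le) hβ
    exact ⟨x, hx, by rwa [zero_add] at h⟩

open Ordinal in
theorem theorem1 :
    IsWellOrderedOfType defectSet (Ordinal.omega0 ^ Ordinal.omega0) ∧
    (∀ k : ℕ, 1 ≤ k →
      IsWellOrderedOfType (defectSet ∩ Set.Ico (0 : ℝ) (k : ℝ))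
        (Ordinal.omega0 ^ (k : Ordinal.{0}))) ∧
    (∀ k : ℕ, k ≠ 1 →
      IsWellOrderedOfType (defectSet ∩ Set.Icc (0 : ℝ) (k : ℝ))
        (Ordinal.omega0 ^ (k : Ordinal.{0}))) ∧
    IsWellOrderedOfType (defectSet ∩ Set.Icc (0 : ℝ) 1) (Ordinal.omega0 + 1) := by
  refine ⟨?_, fun k hk => ?_, fun k hk => ?_, ?_⟩
  · refine isWellOrderedOfType_of defectSet_subset_closedDefects (fun a ha => ?_)
      fun φ hφ β hβ => ?_
    · obtain ⟨k, hk⟩ := exists_nat_gt a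
      obtain ⟨φ, h1, -, h3⟩ := exists_rank k
      refine ⟨φ, fun x hx y hy hxy => h3 x y hxy (lt_of_le_of_lt hy.2 hk)
        (defectSet_subset_closedDefects hy.1), (h1 a hk).trans ?_⟩
      rw [← opow_natCast]
      exact (opow_lt_opow_iff_right one_lt_omega0).2 (natCast_lt_omega0 k)
    · obtain ⟨c, hc, hβ⟩ := (lt_opow_of_isSuccLimit omega0_ne_zero isSuccLimit_omega0).1 hβ
      obtain ⟨k, rfl⟩ := lt_omega0.1 hc
      have hβ' : β < ω ^ (k + 1) := by
        rw [← opow_natCast]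
        exact hβ.trans ((opow_lt_opow_iff_right one_lt_omega0).2 (by exact_mod_cast k.lt_succ_self))
      obtain ⟨x, hx, h⟩ := ((omegaPowLarge_defectSet (k := k + 1) (by omega)).mono
        Set.inter_subset_left).exists_le hφ (fun _ _ => zero_le) hβ'
      exact ⟨x, hx, by rwa [zero_add] at h⟩
  · rw [opow_natCast]
    exact isWellOrderedOfType_Ico hk
  · rw [opow_natCast]
    rcases Nat.eq_zero_or_pos k with rfl | hpos
    · have hS : defectSet ∩ Set.Icc (0 : ℝ) (0 : ℕ) = {0} := by
        rw [Nat.cast_zero, Set.Icc_self, Set.inter_eq_right, Set.singleton_subset_iff]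
        exact zero_mem_defectSet
      rw [hS, pow_zero]
      refine isWellOrderedOfType_of
        (Set.singleton_subset_iff.2 (defectSet_subset_closedDefects zero_mem_defectSet))
        (fun a _ => ⟨fun _ => 0, ?_, zero_lt_one⟩) fun φ _ β hβ => ?_
      · rintro x ⟨rfl, -⟩ y ⟨rfl, -⟩ hxy
        exact absurd hxy (lt_irrefl _)
      · exact ⟨0, rfl, by rw [Order.lt_one_iff.1 hβ]; exact zero_le⟩
    · have hS : defectSet ∩ Set.Icc (0 : ℝ) k = defectSet ∩ Set.Ico (0 : ℝ) k := by
        ext x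
        refine ⟨fun hx => ⟨hx.1, hx.2.1, lt_of_le_of_ne hx.2.2 ?_⟩,
          fun hx => ⟨hx.1, hx.2.1, hx.2.2.le⟩⟩
        rintro rfl
        exact natCast_notMem_defectSet (by omega) hx.1
      rw [hS]
      exact isWellOrderedOfType_Ico hpos
  · have h1S : (1 : ℝ) ∈ defectSet ∩ Set.Icc (0 : ℝ) 1 :=
      ⟨⟨1, le_rfl, defect_one_eq⟩, zero_le_one, le_rfl⟩
    refine isWellOrderedOfType_of (Set.inter_subset_left.trans defectSet_subset_closedDefects)
      (fun a ha => ?_) fun φ hφ β hβ => ⟨1, h1S, ?_⟩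
    · classical
      obtain ⟨φ, h1, -, h3⟩ := exists_rank 1
      rw [Nat.cast_one, pow_one] at *
      refine ⟨fun x => if x < 1 then φ x else ω, fun x hx y hy hxy => ?_, ?_⟩
      · have hx1 : x < 1 := hxy.trans_le hy.1.2.2
        dsimp only
        rw [if_pos hx1]
        split_ifs with hy1
        · exact h3 x y hxy hy1 (defectSet_subset_closedDefects hy.1.1)
        · exact h1 x hx1
      · have hω : ω < ω + 1 := Order.lt_add_one_iff.2 le_rfl
        dsimp only
        split_ifs with ha1
        · exact (h1 a ha1).trans hω
        · exact hω
    · -- The point `1` lies above a set of type `ω`.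
      refine (Order.lt_add_one_iff.1 hβ).trans (le_of_forall_lt fun γ hγ => ?_)
      have hsub : defectSet ∩ Set.Ico (0 : ℝ) (1 : ℕ) ⊆ defectSet ∩ Set.Icc (0 : ℝ) 1 :=
        fun x hx => ⟨hx.1, hx.2.1, by simpa using hx.2.2.le⟩
      obtain ⟨x, hx, h⟩ := (omegaPowLarge_defectSet le_rfl).exists_le (hφ.mono hsub)
        (fun _ _ => zero_le) (by rwa [pow_one] : γ < ω ^ 1)
      rw [zero_add] at h
      exact h.trans_lt (hφ (hsub hx) h1S (by simpa using hx.2.2))
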